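/- Let $k\ge 2$, let $A$ be a finite alphabet, and define the $q$-binomial coefficient $\binom{u}{v}_q\in\mathbb{N}[q]$ of finite words $u,v$ over $A$ by $\binom{u}{\varepsilon}_q=1$, $\binom{\varepsilon}{v}_q=0$ if $v\ne\varepsilon$, and $$\binom{ua}{vb}_q=q^{|vb|}\binom{u}{vb}_q+\delta_{a,b}\binom{u}{v}_q\qquad(a,b\in A).$$ For a left-infinite word $\mathbf{x}=\cdots x_2x_1x_0$ over $A$ and a finite word $z$ over $A$, let $\mathfrak{s}_{\mathbf{x},z}=\sum_{r\ge 0}c_r q^r\in\mathbb{N}[[q]]$, where $c_r$ is the coefficient of $q^r$ in $\binom{x_{N-1}\cdots x_0}{z}_q$, which is the same for all $N\ge r+|z|$. Proposition. Assume that the sequence $(x_n)_{n\ge 0}$ is $k$-automatic, that is, there is a finite deterministic automaton with output which, on reading any base-$k$ representation of $n$ (most significant digit first, leading zeros allowed), outputs $x_n$, for every $n\ge 0$. Then the sequence of coefficients of $\mathfrak{s}_{\mathbf{x},z}$ is $k$-regular: the $\mathbb{Z}$-module generated by the sequences $(c_{k^e n+i})_{n\ge 0}$ with $e\ge 0$ and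 $0\le i<k^e$ is finitely generated. Moreover, write $z=z_\ell\cdots z_1$ and, for $n\ge0$, let $$T_n=\Bigl\{(i_\ell,\ldots,i_1)\in\mathbb{N}^\ell : i_\ell>\cdots>i_1,\ x_{i_j}=z_j\ (1\le j\le \ell),\ i_\ell+\cdots+i_1=n+\tfrac{\ell(\ell-1)}{2}\Bigr\}.$$ Then $T_n$ is finite and $c_n=\#T_n$ for every $n\ge 0$, and the relation $\{(n,i_\ell,\ldots,i_1) : (i_\ell,\ldots,i_1)\in T_n\}$ is first-order definable without parameters in the structure $\langle\mathbb{N},+,V_k\rangle$, where $V_k(m)$ is the largest power of $k$ dividing $m$ for $m\ge 1$, and $V_k(0)=1$. -/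

import Mathlib

open Polynomial

namespace QParikh

section Words

variable {A : Type*} [DecidableEq A]

/-- Auxiliary recursion for the `q`-binomial of two words: both words are given from right to left,
so that the head of each list is the rightmost letter of the word. -/
noncomputable def qbinRev : List A → List A → ℕ[X]
  | _, [] => 1
  | [], _ :: _ => 0
  | a :: u, b :: v => qbinRev u (b :: v) * X ^ (v.length + 1) + if a = b then qbinRev u v else 0

/-- The `q`-binomial coefficient of two finite words (lists read from left to right);
`X` plays the role of `q`. It is characterized by the three lemmas that follow. -/
noncomputable def qbin (u v : List A) : ℕ[X] := qbinRev u.reverse v.reverse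

theorem qbin_nil_right (u : List A) : qbin u [] = 1 := by
  simp [qbin, qbinRev]

theorem qbin_nil_left (v : List A) (hv : v ≠ []) : qbin ([] : List A) v = 0 := by
  unfold qbin
  rcases h : v.reverse with _ | ⟨b, w⟩
  · simp_all
  · simp [qbinRev]

theorem qbin_concat_concat (u v : List A) (a b : A) :
    qbin (u ++ [a]) (v ++ [b]) =
      qbin u (v ++ [b]) * X ^ (v ++ [b]).length + (if a = b then 1 else 0) * qbin u v := by
  simp [qbin, qbinRev]

/-- The prefix `x_{n-1} ⋯ x_0` of length `n` of the left-infinite word `⋯ x_2 x_1 x_0`. -/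
def leftPrefix {A : Type*} (x : ℕ → A) (n : ℕ) : List A := ((List.range n).map x).reverse

/-- The formal power series `∑ c_r q^r`, where `c_r` is the common value of the coefficient of `q^r`
in the `q`-binomials of all prefixes of length at least `r + |z|` of the left-infinite word with `z`
(see `coeff_qSeries` for the independence of the prefix). -/
noncomputable def qSeries (x : ℕ → A) (z : List A) : PowerSeries ℕ :=
  PowerSeries.mk fun r => (qbin (leftPrefix x (r + z.length)) z).coeff r

theorem coeff_qbinRev_concat (u v : List A) (a : A) (r : ℕ) (h : r + v.length ≤ u.length) :
    (qbinRev (u ++ [a]) v).coeff r = (qbinRev u v).coeff r := by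
  induction u generalizing v r with
  | nil =>
    cases v with
    | nil => simp [qbinRev]
    | cons b v => simp at h
  | cons c u ih =>
    cases v with
    | nil => simp [qbinRev]
    | cons b v =>
      simp only [List.length_cons] at h
      simp only [List.cons_append, qbinRev, coeff_add, coeff_mul_X_pow']
      congr 1
      · split_ifs with h1
        · exact ih _ _ (by simp only [List.length_cons]; omega)
        · rfl
      · split_ifs
        · exact ih _ _ (by omega)
        · rfl

theorem coeff_qSeries (x : ℕ → A) (z : List A) (r N : ℕ) (h : r + z.length ≤ N) :
    PowerSeries.coeff r (qSeries x z) = (qbin (leftPrefix x N) z).coeff r := by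
  induction N, h using Nat.le_induction with
  | base => simp [qSeries]
  | succ N hN ih =>
    rw [ih]
    simp only [qbin, leftPrefix, List.reverse_reverse, List.range_succ, List.map_append,
      List.map_cons, List.map_nil]
    exact (coeff_qbinRev_concat _ _ _ _ (by simpa using hN)).symm

/-- For `z = z_0 ⋯ z_{ℓ-1}`, the tuples `i_0 > ⋯ > i_{ℓ-1}` of positions of occurrences of `z` as a
subword of `⋯ x_2 x_1 x_0` such that `n = i_0 + ⋯ + i_{ℓ-1} - ℓ(ℓ-1)/2`. -/
def occurrences {A : Type*} (x : ℕ → A) (z : List A) (n : ℕ) : Set (Fin z.length → ℕ) :=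
  {i | StrictAnti i ∧ (∀ j, x (i j) = z.get j) ∧ ∑ j, i j = n + z.length * (z.length - 1) / 2}

end Words

/-- A deterministic automaton with output: input alphabet `α`, states `σ`, output alphabet `A`. -/
structure DFAO (α σ A : Type*) where
  step : σ → α → σ
  start : σ
  out : σ → A

/-- The value of a base-`k` digit string, most significant digit first, leading zeros allowed. -/
def msdValue {k : ℕ} (w : List (Fin k)) : ℕ := Nat.ofDigits k (w.reverse.map Fin.val)

/-- `x` is `k`-automatic: some finite automaton with output, reading base-`k` digits, produces `x n`
on every string representing `n` (most significant digit first). -/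
def IsKAutomatic {A : Type*} (k : ℕ) (x : ℕ → A) : Prop :=
  ∃ (σ : Type) (_ : Finite σ) (M : DFAO (Fin k) σ A),
    ∀ w : List (Fin k), M.out (w.foldl M.step M.start) = x (msdValue w)

/-- The `k`-kernel of a sequence. -/
def kKernel {R : Type*} (k : ℕ) (s : ℕ → R) : Set (ℕ → R) :=
  {t | ∃ e i : ℕ, i < k ^ e ∧ t = fun n => s (k ^ e * n + i)}

/-- A sequence of integers is `k`-regular if the `ℤ`-module generated by its `k`-kernel is
finitely generated. -/
def IsKRegular (k : ℕ) (s : ℕ → ℤ) : Prop := (Submodule.span ℤ (kKernel k s)).FG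

/-- `V_k n` is the largest power of `k` dividing `n`, with `V_k 0 = 1`. -/
noncomputable def powVal (k n : ℕ) : ℕ := if n = 0 then 1 else k ^ multiplicity k n

/-- The function symbols of the language of `⟨ℕ, +, V_k⟩`. -/
inductive BuchiFunc : ℕ → Type
  | add : BuchiFunc 2
  | val : BuchiFunc 1

/-- The first-order language of `⟨ℕ, +, V_k⟩` (equality is a logical symbol). -/
def buchiLanguage : FirstOrder.Language := ⟨BuchiFunc, fun _ => Empty⟩

/-- The structure `⟨ℕ, +, V_k⟩`. -/
@[reducible]
noncomputable def buchiStructure (k : ℕ) : buchiLanguage.Structure ℕ where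
  funMap := fun f v =>
    match f, v with
    | BuchiFunc.add, v => v 0 + v 1
    | BuchiFunc.val, v => powVal k (v 0)
  RelMap := fun r _ => Empty.elim r

/-- First-order definability (without parameters) in `⟨ℕ, +, V_k⟩`. -/
def BuchiDefinable (k : ℕ) {ι : Type*} (S : Set (ι → ℕ)) : Prop :=
  letI := buchiStructure k
  Set.Definable (∅ : Set ℕ) buchiLanguage S

end QParikh

/-!
Reading off the letter `x 0` turns the recurrence of the `q`-binomials into
`qSeries x (z ++ [b]) = X ^ (|z| + 1) * qSeries (x ∘ succ) (z ++ [b]) + δ * qSeries (x ∘ succ) z`,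
where `δ` is `1` if `x 0 = b` and `0` otherwise. The generating function of the position tuples of
`z` by their sum, divided by `X ^ (ℓ(ℓ-1)/2)`, satisfies the same recurrence, according to whether
the last letter of `z` is read at position `0`. Since multiplication by `X ^ (|z| + 1)` is
contracting, the two series coincide, so the coefficients count occurrences.

The relation `i ∈ occurrences x z n` is recognized by a finite automaton that reads the base-`k`
digits of `n` and of the positions in parallel, least significant digit first: finite kernels,
linear equations and intersections all lead to finite families of sets closed under appending
digits. Counting the fibers over `n` of the members of such a family gives a finitely generated
`ℤ`-module closed under `n ↦ k n + r`, hence regularity. Definability is Büchi's argument: an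
accepting run is encoded by numbers whose base-`k` digits mark the state reached after each step.
-/

namespace QParikh

section Subwords

variable {A : Type*} {ℓ : ℕ}

/-- The decreasing tuples of positions with sum `s` at which `z` occurs as a subword of
`⋯ x_2 x_1 x_0`. The letters of `z` are indexed from left to right. -/
def subwordPositions (x : ℕ → A) (z : Fin ℓ → A) (s : ℕ) : Set (Fin ℓ → ℕ) :=
  {i | StrictAnti i ∧ (∀ j, x (i j) = z j) ∧ ∑ j, i j = s}

theorem finite_subwordPositions (x : ℕ → A) (z : Fin ℓ → A) (s : ℕ) :
    (subwordPositions x z s).Finite := by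
  refine (Set.finite_Iic fun _ => s).subset ?_
  rintro i ⟨-, -, rfl⟩ j
  exact Finset.single_le_sum (fun _ _ => Nat.zero_le _) (Finset.mem_univ j)

/-- The generating series of the occurrences of `z` as a subword of `⋯ x_2 x_1 x_0`, according to
the sum of their positions. -/
noncomputable def positionSeries (x : ℕ → A) (z : Fin ℓ → A) : PowerSeries ℕ :=
  PowerSeries.mk fun s => (subwordPositions x z s).ncard

theorem positionSeries_zero (x : ℕ → A) (z : Fin 0 → A) : positionSeries x z = 1 := by
  ext s
  have hset : subwordPositions x z s = {_i | 0 = s} := by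
    ext i
    simp [subwordPositions, Subsingleton.strictAnti]
  rw [positionSeries, PowerSeries.coeff_mk, hset, PowerSeries.coeff_one]
  split_ifs with hs
  · simp [hs, Set.ncard_univ]
  · simp [Ne.symm hs]

theorem image_succ_subwordPositions (x : ℕ → A) (z : Fin ℓ → A) (s : ℕ) :
    (Nat.succ ∘ ·) '' subwordPositions (x ∘ Nat.succ) z s =
      {i ∈ subwordPositions x z (s + ℓ) | ∀ j, 0 < i j} := by
  ext i
  constructor
  · rintro ⟨i, ⟨hanti, hletter, hsum⟩, rfl⟩
    refine ⟨⟨fun a b hab => Nat.succ_lt_succ (hanti hab), hletter, ?_⟩, fun j => Nat.succ_pos _⟩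
    simp [Finset.sum_add_distrib, hsum]
  · rintro ⟨⟨hanti, hletter, hsum⟩, hpos⟩
    obtain ⟨i, rfl⟩ : ∃ i' : Fin ℓ → ℕ, i = Nat.succ ∘ i' :=
      ⟨Nat.pred ∘ i, funext fun j => (Nat.succ_pred (hpos j).ne').symm⟩
    refine ⟨i, ⟨fun a b hab => Nat.lt_of_succ_lt_succ (hanti hab), hletter, ?_⟩, rfl⟩
    simpa [Finset.sum_add_distrib] using hsum

theorem ncard_pos_subwordPositions (x : ℕ → A) (z : Fin ℓ → A) (s : ℕ) :
    {i ∈ subwordPositions x z s | ∀ j, 0 < i j}.ncard =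
      PowerSeries.coeff s (PowerSeries.X ^ ℓ * positionSeries (x ∘ Nat.succ) z) := by
  rw [PowerSeries.coeff_X_pow_mul']
  split_ifs with hs
  · obtain ⟨s, rfl⟩ := Nat.exists_eq_add_of_le' hs
    rw [← image_succ_subwordPositions, Nat.add_sub_cancel, positionSeries, PowerSeries.coeff_mk]
    exact Set.ncard_image_of_injective _ Nat.succ_injective.comp_left
  · have hempty : {i ∈ subwordPositions x z s | ∀ j, 0 < i j} = ∅ := by
      refine Set.eq_empty_of_forall_notMem ?_
      rintro i ⟨⟨-, -, hsum⟩, hpos⟩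
      have : ∑ _j : Fin ℓ, 1 ≤ ∑ j, i j := Finset.sum_le_sum fun j _ => hpos j
      simp at this
      omega
    rw [hempty, Set.ncard_empty]

theorem strictAnti_snoc_iff {α : Type*} [Preorder α] {i : Fin ℓ → α} {a : α} :
    StrictAnti (Fin.snoc i a : Fin (ℓ + 1) → α) ↔ StrictAnti i ∧ ∀ j, a < i j := by
  refine ⟨fun h => ⟨fun b c hbc => ?_, fun j => ?_⟩, fun ⟨hi, ha⟩ => ?_⟩
  · simpa using h (Fin.castSucc_lt_castSucc_iff.2 hbc)
  · simpa using h (Fin.castSucc_lt_last j)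
  · intro b c hbc
    cases b using Fin.lastCases with
    | last => exact absurd hbc (Fin.le_last c).not_gt
    | cast b =>
      cases c using Fin.lastCases with
      | last => simpa using ha b
      | cast c => simpa using hi (Fin.castSucc_lt_castSucc_iff.1 hbc)

theorem snoc_zero_mem_subwordPositions_iff {x : ℕ → A} {z : Fin (ℓ + 1) → A} {s : ℕ}
    {i : Fin ℓ → ℕ} :
    (Fin.snoc i 0 : Fin (ℓ + 1) → ℕ) ∈ subwordPositions x z s ↔
      x 0 = z (Fin.last ℓ) ∧ i ∈ {i ∈ subwordPositions x (Fin.init z) s | ∀ j, 0 < i j} := by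
  simp only [subwordPositions, Set.mem_ofPred_eq, strictAnti_snoc_iff, Fin.forall_fin_succ',
    Fin.sum_univ_castSucc, Fin.snoc_castSucc, Fin.snoc_last, add_zero, Fin.init]
  tauto

theorem ncard_last_eq_zero_subwordPositions [DecidableEq A] (x : ℕ → A) (z : Fin (ℓ + 1) → A)
    (s : ℕ) :
    {i ∈ subwordPositions x z s | i (Fin.last ℓ) = 0}.ncard =
      if x 0 = z (Fin.last ℓ) then
        {i ∈ subwordPositions x (Fin.init z) s | ∀ j, 0 < i j}.ncard else 0 := by
  have himage : {i ∈ subwordPositions x z s | i (Fin.last ℓ) = 0} =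
      (fun i : Fin ℓ → ℕ => (Fin.snoc i 0 : Fin (ℓ + 1) → ℕ)) ''
        {i | (Fin.snoc i 0 : Fin (ℓ + 1) → ℕ) ∈ subwordPositions x z s} := by
    ext i
    constructor
    · rintro ⟨hi, hlast⟩
      have hsnoc : (Fin.snoc (Fin.init i) 0 : Fin (ℓ + 1) → ℕ) = i := by
        rw [← hlast, Fin.snoc_init_self]
      exact ⟨Fin.init i, by rwa [Set.mem_ofPred_eq, hsnoc], hsnoc⟩
    · rintro ⟨i, hi, rfl⟩
      exact ⟨hi, Fin.snoc_last _ _⟩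
  rw [himage, Set.ncard_image_of_injective _ (Fin.snoc_left_injective (α := fun _ => ℕ) 0)]
  simp only [snoc_zero_mem_subwordPositions_iff]
  split_ifs with h <;> simp [h]

theorem positionSeries_succ [DecidableEq A] (x : ℕ → A) (z : Fin (ℓ + 1) → A) :
    positionSeries x z = PowerSeries.X ^ (ℓ + 1) * positionSeries (x ∘ Nat.succ) z +
      if x 0 = z (Fin.last ℓ) then
        PowerSeries.X ^ ℓ * positionSeries (x ∘ Nat.succ) (Fin.init z) else 0 := by
  ext s
  have hpos : {i ∈ subwordPositions x z s | ¬i (Fin.last ℓ) = 0} =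
      {i ∈ subwordPositions x z s | ∀ j, 0 < i j} := by
    ext i
    refine and_congr_right fun hi => ⟨fun hlast j => ?_, fun h => (h _).ne'⟩
    exact (Nat.pos_of_ne_zero hlast).trans_le (hi.1.antitone (Fin.le_last j))
  rw [map_add, apply_ite (PowerSeries.coeff s), map_zero, ← ncard_pos_subwordPositions,
    ← ncard_pos_subwordPositions, ← ncard_last_eq_zero_subwordPositions, ← hpos, positionSeries,
    PowerSeries.coeff_mk]
  exact ((add_comm _ _).trans (Set.ncard_inter_add_ncard_sdiff_eq_ncard _
    {i | i (Fin.last ℓ) = 0} (finite_subwordPositions x z s))).symm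

end Subwords

section QSeries

variable {A : Type*} [DecidableEq A]

theorem leftPrefix_succ {A : Type*} (x : ℕ → A) (N : ℕ) :
    leftPrefix x (N + 1) = leftPrefix (x ∘ Nat.succ) N ++ [x 0] := by
  simp [leftPrefix, List.range_succ_eq_map]

theorem qSeries_nil (x : ℕ → A) : qSeries x [] = 1 := by
  ext r
  simp [qSeries, qbin_nil_right, PowerSeries.coeff_one, coeff_one]

theorem qSeries_concat (x : ℕ → A) (z : List A) (b : A) :
    qSeries x (z ++ [b]) = PowerSeries.X ^ (z.length + 1) * qSeries (x ∘ Nat.succ) (z ++ [b]) +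
      if x 0 = b then qSeries (x ∘ Nat.succ) z else 0 := by
  ext r
  have hlength : (z ++ [b]).length = z.length + 1 := List.length_append
  rw [coeff_qSeries x (z ++ [b]) r (r + z.length + 1 + 1) (by omega), leftPrefix_succ,
    qbin_concat_concat, hlength, map_add, PowerSeries.coeff_X_pow_mul', coeff_add, coeff_mul_X_pow']
  congr 1
  · split_ifs
    · rw [coeff_qSeries _ _ _ (r + z.length + 1) (by omega)]
    · rfl
  · split_ifs
    · rw [one_mul, coeff_qSeries _ _ _ (r + z.length + 1) (by omega)]
    · simp

theorem eq_of_eq_X_pow_mul_add {ι R : Type*} [Semiring R] {m : ℕ} (hm : 0 < m) {σ : ι → ι}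
    {f g h : ι → PowerSeries R} (hf : ∀ a, f a = PowerSeries.X ^ m * f (σ a) + h a)
    (hg : ∀ a, g a = PowerSeries.X ^ m * g (σ a) + h a) (a : ι) : f a = g a := by
  ext n
  induction n using Nat.strong_induction_on generalizing a with
  | _ n ih =>
    rw [hf, hg, map_add, map_add, PowerSeries.coeff_X_pow_mul', PowerSeries.coeff_X_pow_mul']
    split_ifs with hmn
    · rw [ih (n - m) (by omega)]
    · rfl

theorem X_pow_mul_qSeries_ofFn {ℓ : ℕ} (x : ℕ → A) (z : Fin ℓ → A) :
    PowerSeries.X ^ (ℓ * (ℓ - 1) / 2) * qSeries x (List.ofFn z) = positionSeries x z := by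
  induction ℓ generalizing x with
  | zero => simp [qSeries_nil, positionSeries_zero]
  | succ ℓ ih =>
    refine eq_of_eq_X_pow_mul_add ℓ.succ_pos (σ := (· ∘ Nat.succ))
      (f := fun x => PowerSeries.X ^ ((ℓ + 1) * ℓ / 2) * qSeries x (List.ofFn z))
      (fun x => ?_) (fun x => positionSeries_succ x z) x
    have htriangle : (ℓ + 1) * ℓ / 2 = ℓ + ℓ * (ℓ - 1) / 2 := by
      simpa [add_comm ℓ] using Nat.triangle_succ ℓ
    have hofFn : List.ofFn z = List.ofFn (Fin.init z) ++ [z (Fin.last ℓ)] := by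
      rw [List.ofFn_succ', List.concat_eq_append]; rfl
    conv_lhs => rw [hofFn, qSeries_concat, ← hofFn, List.length_ofFn]
    rw [mul_add, mul_left_comm, mul_ite, mul_zero, ← ih, ← mul_assoc (PowerSeries.X ^ ℓ), ← pow_add,
      ← htriangle]

theorem coeff_qSeries_eq_ncard_occurrences (x : ℕ → A) (z : List A) (n : ℕ) :
    PowerSeries.coeff n (qSeries x z) = (occurrences x z n).ncard := by
  have h := congrArg (PowerSeries.coeff (n + z.length * (z.length - 1) / 2))
    (X_pow_mul_qSeries_ofFn x z.get)
  rwa [List.ofFn_get, PowerSeries.coeff_X_pow_mul, positionSeries, PowerSeries.coeff_mk] at h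

end QSeries

section Kernel

variable {R : Type*} {k : ℕ} {s t : ℕ → R}

theorem self_mem_kKernel (k : ℕ) (s : ℕ → R) : s ∈ kKernel k s :=
  ⟨0, 0, by simp, by simp⟩

theorem decimate_mem_kKernel (ht : t ∈ kKernel k s) (d : Fin k) :
    (fun n => t (k * n + d)) ∈ kKernel k s := by
  obtain ⟨e, i, hi, rfl⟩ := ht
  refine ⟨e + 1, k ^ e * d + i, ?_, funext fun n => congrArg s (by ring)⟩
  calc k ^ e * d + i < k ^ e * (d + 1) := by rw [mul_add_one]; omega
    _ ≤ k ^ (e + 1) := Nat.mul_le_mul_left _ d.2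

theorem kKernel_subset {P : Set (ℕ → R)} (hs : s ∈ P)
    (hP : ∀ t ∈ P, ∀ d : Fin k, (fun n => t (k * n + d)) ∈ P) : kKernel k s ⊆ P := by
  rintro _ ⟨e, i, hi, rfl⟩
  induction e generalizing i with
  | zero => simpa [Nat.lt_one_iff.1 hi] using hs
  | succ e ih =>
    have hpos : 0 < k ^ e := Nat.pos_of_ne_zero fun h => by simp [pow_succ, h] at hi
    have hdigit : i / k ^ e < k := Nat.div_lt_of_lt_mul (by rwa [← pow_succ])
    have hsplit (n : ℕ) : k ^ (e + 1) * n + i = k ^ e * (k * n + i / k ^ e) + i % k ^ e := by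
      conv_lhs => rw [← Nat.div_add_mod i (k ^ e)]
      ring
    simpa only [hsplit] using hP _ (ih _ (Nat.mod_lt i hpos)) ⟨i / k ^ e, hdigit⟩

theorem isKRegular_of_mem {s : ℕ → ℤ} {M : Submodule ℤ (ℕ → ℤ)} (hM : M.FG)
    (hdec : ∀ t ∈ M, ∀ d : Fin k, (fun n => t (k * n + d)) ∈ M) (hs : s ∈ M) :
    IsKRegular k s :=
  have := isNoetherian_of_fg_of_noetherian M hM
  Submodule.FG.of_le_of_isNoetherian (Submodule.span_le.2 (kKernel_subset hs hdec))

end Kernel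

section Automatic

variable {A B : Type*} {k : ℕ} {x : ℕ → A}

theorem IsKAutomatic.comp (hx : IsKAutomatic k x) (f : A → B) : IsKAutomatic k (f ∘ x) := by
  obtain ⟨σ, hσ, M, hM⟩ := hx
  exact ⟨σ, hσ, ⟨M.step, M.start, f ∘ M.out⟩, fun w => congrArg f (hM w)⟩

theorem exists_msdValue_eq (hk : 2 ≤ k) (n : ℕ) : ∃ w : List (Fin k), msdValue w = n := by
  refine ⟨((Nat.digits k n).pmap Fin.mk fun d hd => Nat.digits_lt_base hk hd).reverse, ?_⟩
  rw [msdValue, List.reverse_reverse, List.map_pmap]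
  simp [Nat.ofDigits_digits]

theorem msdValue_append (u w : List (Fin k)) :
    msdValue (u ++ w) = k ^ w.length * msdValue u + msdValue w := by
  simp only [msdValue, List.reverse_append, List.map_append, Nat.ofDigits_append, List.length_map,
    List.length_reverse]
  ring

theorem msdValue_cons (d : Fin k) (w : List (Fin k)) :
    msdValue (d :: w) = k ^ w.length * d + msdValue w := by
  rw [← List.singleton_append, msdValue_append]
  simp [msdValue]

theorem IsKAutomatic.finite_kKernel (hk : 2 ≤ k) (hx : IsKAutomatic k x) :
    (kKernel k x).Finite := by
  obtain ⟨σ, _, M, hM⟩ := hx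
  choose rep hrep using exists_msdValue_eq hk
  let suffixed (w : List (Fin k)) (n : ℕ) : A := x (k ^ w.length * n + msdValue w)
  let ofTransition (f : σ → σ) (n : ℕ) : A := M.out (f ((rep n).foldl M.step M.start))
  have hsuffixed (w : List (Fin k)) : suffixed w = ofTransition fun q => w.foldl M.step q := by
    funext n
    simp only [suffixed, ofTransition]
    rw [← List.foldl_append, hM, msdValue_append, hrep]
  have hfinite : (Set.range suffixed).Finite := by
    refine (Set.finite_range ofTransition).subset ?_
    rintro _ ⟨w, rfl⟩
    exact ⟨fun q => w.foldl M.step q, (hsuffixed w).symm⟩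
  refine hfinite.subset (kKernel_subset ⟨[], by simp [suffixed, msdValue]⟩ ?_)
  rintro _ ⟨w, rfl⟩ d
  refine ⟨d :: w, funext fun n => congrArg x ?_⟩
  rw [msdValue_cons, List.length_cons]
  ring

end Automatic

section Recognizable

variable {k : ℕ} {ι : Type*}

/-- The tuple whose base-`k` representations are those of the entries of `v`, each followed by the
corresponding digit of `d`. -/
def appendDigits (k : ℕ) (v : ι → ℕ) (d : ι → Fin k) : ι → ℕ := fun j => k * v j + d j

theorem appendDigits_div_mod [NeZero k] (v : ι → ℕ) :
    appendDigits k (fun j => v j / k) (fun j => Fin.ofNat k (v j)) = v :=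
  funext fun j => Nat.div_add_mod (v j) k

theorem appendDigits_injective [NeZero k] (d : ι → Fin k) :
    Function.Injective fun v => appendDigits k v d := fun _ _ h =>
  funext fun j => Nat.eq_of_mul_eq_mul_left (NeZero.pos k) (Nat.add_right_cancel (congrFun h j))

theorem appendDigits_bijective [NeZero k] :
    Function.Bijective fun p : (ι → Fin k) × (ι → ℕ) => appendDigits k p.2 p.1 := by
  refine ⟨fun ⟨d, v⟩ ⟨d', v'⟩ h => ?_, fun v => ⟨(_, _), appendDigits_div_mod v⟩⟩
  have hd : d = d' := funext fun j => Fin.ext <| by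
    simpa [appendDigits, Nat.mod_eq_of_lt] using congrArg (· % k) (congrFun h j)
  subst hd
  exact congrArg (Prod.mk d) (appendDigits_injective d h)

theorem appendDigits_cons {m : ℕ} (n : ℕ) (i : Fin m → ℕ) (r : Fin k) (d : Fin m → Fin k) :
    appendDigits k (Fin.cons n i : Fin (m + 1) → ℕ) (Fin.cons r d : Fin (m + 1) → Fin k) =
      (Fin.cons (k * n + r) (appendDigits k i d) : Fin (m + 1) → ℕ) := by
  funext j
  cases j using Fin.cases <;> rfl

/-- The set of tuples `v` for which appending the digits `d` to the base-`k` representations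
of the entries of `v` gives an element of `S`. -/
def digitQuotient (S : Set (ι → ℕ)) (d : ι → Fin k) : Set (ι → ℕ) :=
  {v | appendDigits k v d ∈ S}

/-- A set of tuples of natural numbers is `k`-recognizable if it lies in a finite family of sets
that is closed under `digitQuotient`: the states of an automaton that reads the base-`k` digits of
all entries in parallel, least significant digit first. -/
def IsRecognizable (k : ℕ) (S : Set (ι → ℕ)) : Prop :=
  ∃ K : Set (Set (ι → ℕ)), K.Finite ∧ S ∈ K ∧ ∀ T ∈ K, ∀ d : ι → Fin k, digitQuotient T d ∈ K

theorem isRecognizable_univ : IsRecognizable k (Set.univ : Set (ι → ℕ)) := by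
  refine ⟨{Set.univ}, Set.finite_singleton _, rfl, ?_⟩
  rintro _ rfl d
  rfl

theorem IsRecognizable.inter {S T : Set (ι → ℕ)} (hS : IsRecognizable k S)
    (hT : IsRecognizable k T) : IsRecognizable k (S ∩ T) := by
  obtain ⟨K, hK, hSK, hKd⟩ := hS
  obtain ⟨L, hL, hTL, hLd⟩ := hT
  refine ⟨Set.image2 (· ∩ ·) K L, hK.image2 _ hL, ⟨S, hSK, T, hTL, rfl⟩, ?_⟩
  rintro _ ⟨U, hU, V, hV, rfl⟩ d
  exact ⟨_, hKd U hU d, _, hLd V hV d, rfl⟩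

theorem IsRecognizable.iInter {α : Type*} [Finite α] {S : α → Set (ι → ℕ)}
    (hS : ∀ a, IsRecognizable k (S a)) : IsRecognizable k (⋂ a, S a) := by
  classical
  have := Fintype.ofFinite α
  suffices h : ∀ s : Finset α, IsRecognizable k (⋂ a ∈ s, S a) by simpa using h Finset.univ
  intro s
  induction s using Finset.induction with
  | empty => simpa using isRecognizable_univ
  | insert a s _ ih =>
    rw [Finset.set_biInter_insert]
    exact (hS a).inter ih

theorem isRecognizable_of_finite_kKernel {p : ℕ → Prop} (hp : (kKernel k p).Finite) (j : ι) :
    IsRecognizable k {v : ι → ℕ | p (v j)} := by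
  refine ⟨(fun q : ℕ → Prop => {v : ι → ℕ | q (v j)}) '' kKernel k p, hp.image _,
    ⟨p, self_mem_kKernel k p, rfl⟩, ?_⟩
  rintro _ ⟨q, hq, rfl⟩ d
  exact ⟨_, decimate_mem_kKernel hq (d j), rfl⟩

theorem digitQuotient_sum_mul_le [NeZero k] [Fintype ι] (a : ι → ℤ) (c : ℤ) (d : ι → Fin k) :
    digitQuotient {v : ι → ℕ | ∑ j, a j * v j ≤ c} d =
      {v | ∑ j, a j * v j ≤ (c - ∑ j, a j * (d j : ℕ)) / k} := by
  ext v
  have hsum : ∑ j, a j * (appendDigits k v d j : ℤ) =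
      (∑ j, a j * v j) * k + ∑ j, a j * (d j : ℕ) := by
    rw [Finset.sum_mul, ← Finset.sum_add_distrib]
    refine Finset.sum_congr rfl fun j _ => ?_
    rw [appendDigits]
    push_cast
    ring
  have hk : (0 : ℤ) < k := mod_cast NeZero.pos k
  rw [digitQuotient, Set.mem_ofPred_eq, Set.mem_ofPred_eq, Set.mem_ofPred_eq, hsum,
    Int.le_ediv_iff_mul_le hk, le_sub_iff_add_le]

theorem abs_sum_mul_digit_le [Fintype ι] (a : ι → ℤ) (d : ι → Fin k) :
    |∑ j, a j * ((d j : ℕ) : ℤ)| ≤ (k - 1) * ∑ j, |a j| := by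
  calc |∑ j, a j * ((d j : ℕ) : ℤ)| ≤ ∑ j, |a j * ((d j : ℕ) : ℤ)| :=
        Finset.abs_sum_le_sum_abs _ _
    _ ≤ ∑ j, (k - 1) * |a j| := by
        refine Finset.sum_le_sum fun j _ => ?_
        rw [abs_mul, mul_comm, Nat.abs_cast]
        exact mul_le_mul_of_nonneg_right (by have := (d j).2; omega) (abs_nonneg _)
    _ = (k - 1) * ∑ j, |a j| := (Finset.mul_sum _ _ _).symm

theorem isRecognizable_sum_mul_le [NeZero k] [Fintype ι] (a : ι → ℤ) (c : ℤ) :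
    IsRecognizable k {v : ι → ℕ | ∑ j, a j * v j ≤ c} := by
  let B : ℤ := max |c| (∑ j, |a j|)
  refine ⟨(fun c : ℤ => {v : ι → ℕ | ∑ j, a j * v j ≤ c}) '' Set.Icc (-B) B,
    (Set.finite_Icc _ _).image _, ⟨c, abs_le.1 (le_max_left _ _), rfl⟩, ?_⟩
  rintro _ ⟨c', hc', rfl⟩ d
  have hk : (1 : ℤ) ≤ k := mod_cast NeZero.one_le
  have hbound : |c' - ∑ j, a j * ((d j : ℕ) : ℤ)| ≤ B * k := by
    calc |c' - ∑ j, a j * ((d j : ℕ) : ℤ)| ≤ |c'| + |∑ j, a j * ((d j : ℕ) : ℤ)| := abs_sub _ _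
      _ ≤ B + (k - 1) * B := by
          refine add_le_add (abs_le.2 hc') ((abs_sum_mul_digit_le a d).trans ?_)
          exact mul_le_mul_of_nonneg_left (le_max_right _ _) (by omega)
      _ = B * k := by ring
  obtain ⟨hlower, hupper⟩ := abs_le.1 hbound
  exact ⟨_, ⟨(Int.le_ediv_iff_mul_le (by omega)).2 (by linarith),
    Int.ediv_le_of_le_mul (by omega) hupper⟩, (digitQuotient_sum_mul_le a c' d).symm⟩

theorem isRecognizable_sum_mul_eq [NeZero k] [Fintype ι] (a : ι → ℤ) (c : ℤ) :
    IsRecognizable k {v : ι → ℕ | ∑ j, a j * v j = c} := by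
  convert (isRecognizable_sum_mul_le (k := k) a c).inter
    (isRecognizable_sum_mul_le (-a) (-c)) using 1
  ext v
  simp [le_antisymm_iff]

theorem isRecognizable_lt [NeZero k] [Finite ι] (i j : ι) :
    IsRecognizable k {v : ι → ℕ | v i < v j} := by
  classical
  have := Fintype.ofFinite ι
  convert isRecognizable_sum_mul_le (k := k) (Pi.single i 1 - Pi.single j 1) (-1) using 1
  ext v
  simp only [Pi.sub_apply, Pi.single_apply, sub_mul, ite_mul, one_mul, zero_mul,
    Finset.sum_sub_distrib, Finset.sum_ite_eq', Finset.mem_univ, if_true, Set.mem_ofPred_eq]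
  omega

theorem isRecognizable_occurrences [NeZero k] {A : Type*} {x : ℕ → A} {z : List A}
    (hx : ∀ a ∈ z, (kKernel k fun n => x n = a).Finite) :
    IsRecognizable k {v : Fin (z.length + 1) → ℕ | Fin.tail v ∈ occurrences x z (v 0)} := by
  have hanti : IsRecognizable k (⋂ p : {p : Fin z.length × Fin z.length // p.1 < p.2},
      {v : Fin (z.length + 1) → ℕ | v p.1.2.succ < v p.1.1.succ}) :=
    .iInter fun p => isRecognizable_lt _ _
  have hletters : IsRecognizable k (⋂ j : Fin z.length,
      {v : Fin (z.length + 1) → ℕ | x (v j.succ) = z.get j}) :=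
    .iInter fun j => isRecognizable_of_finite_kKernel (hx _ (z.get_mem j)) j.succ
  have hsum := isRecognizable_sum_mul_eq (k := k)
    (Fin.cons (-1) fun _ => 1 : Fin (z.length + 1) → ℤ) (z.length * (z.length - 1) / 2 : ℕ)
  convert hanti.inter (hletters.inter hsum) using 1
  ext v
  simp only [occurrences, StrictAnti, Fin.tail, Fin.sum_univ_succ, Fin.cons_zero, Fin.cons_succ,
    Set.mem_ofPred_eq, Set.mem_inter_iff, Set.mem_iInter, Subtype.forall, Prod.forall, neg_mul,
    one_mul]
  refine and_congr Iff.rfl (and_congr_right fun _ => ?_)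
  rw [← Nat.cast_inj (R := ℤ), Nat.cast_add, Nat.cast_sum, neg_add_eq_iff_eq_add]

end Recognizable

section Fibers

variable {k m : ℕ} {S : Set (Fin (m + 1) → ℕ)}

/-- The tuples related to `n` by the relation `S`, whose `0`-th argument is `n`. -/
def fiber (S : Set (Fin (m + 1) → ℕ)) (n : ℕ) : Set (Fin m → ℕ) := {i | Fin.cons n i ∈ S}

theorem mem_fiber_digitQuotient_iff {n : ℕ} {i : Fin m → ℕ} {r : Fin k} {d : Fin m → Fin k} :
    i ∈ fiber (digitQuotient S (Fin.cons r d : Fin (m + 1) → Fin k)) n ↔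
      appendDigits k i d ∈ fiber S (k * n + r) := by
  simp only [fiber, digitQuotient, Set.mem_ofPred_eq, appendDigits_cons]

theorem finite_fiber_digitQuotient [NeZero k] (hS : ∀ n, (fiber S n).Finite)
    (d : Fin (m + 1) → Fin k) (n : ℕ) : (fiber (digitQuotient S d) n).Finite := by
  refine ((hS (k * n + d 0)).preimage (appendDigits_injective (Fin.tail d)).injOn).subset
    fun i hi => ?_
  rw [← Fin.cons_self_tail d] at hi
  exact mem_fiber_digitQuotient_iff.1 hi

theorem ncard_fiber_mul_add [NeZero k] (hS : ∀ n, (fiber S n).Finite) (n : ℕ) (r : Fin k) :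
    (fiber S (k * n + r)).ncard = ∑ d : Fin m → Fin k,
      (fiber (digitQuotient S (Fin.cons r d : Fin (m + 1) → Fin k)) n).ncard := by
  have (d : Fin m → Fin k) :
      Finite {i // i ∈ fiber (digitQuotient S (Fin.cons r d : Fin (m + 1) → Fin k)) n} :=
    finite_fiber_digitQuotient hS _ n
  calc (fiber S (k * n + r)).ncard
      = Nat.card {p : (Fin m → Fin k) × (Fin m → ℕ) //
          appendDigits k p.2 p.1 ∈ fiber S (k * n + r)} :=
        (Nat.card_congr ((Equiv.ofBijective _ appendDigits_bijective).subtypeEquiv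
          fun _ => Iff.rfl)).symm
    _ = Nat.card {p : (Fin m → Fin k) × (Fin m → ℕ) //
          p.2 ∈ fiber (digitQuotient S (Fin.cons r p.1 : Fin (m + 1) → Fin k)) n} := by
        simp only [mem_fiber_digitQuotient_iff]
    _ = _ := by
        rw [Nat.card_congr (Equiv.subtypeProdEquivSigmaSubtype fun (d : Fin m → Fin k) i =>
          i ∈ fiber (digitQuotient S (Fin.cons r d : Fin (m + 1) → Fin k)) n), Nat.card_sigma]
        rfl

theorem IsRecognizable.isKRegular_ncard_fiber [NeZero k] (hS : IsRecognizable k S)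
    (hfin : ∀ n, (fiber S n).Finite) : IsKRegular k fun n => ((fiber S n).ncard : ℤ) := by
  obtain ⟨K, hK, hSK, hKd⟩ := hS
  let count (T : Set (Fin (m + 1) → ℕ)) (n : ℕ) : ℤ := (fiber T n).ncard
  let K' := {T ∈ K | ∀ n, (fiber T n).Finite}
  have hK' : K'.Finite := hK.subset fun T hT => hT.1
  refine isKRegular_of_mem (Submodule.fg_span (hK'.image count)) (fun t ht r => ?_)
    (Submodule.subset_span ⟨S, ⟨hSK, hfin⟩, rfl⟩)
  let decimate : (ℕ → ℤ) →ₗ[ℤ] (ℕ → ℤ) := LinearMap.funLeft ℤ ℤ fun n => k * n + r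
  suffices h : Submodule.span ℤ (count '' K') ≤ (Submodule.span ℤ (count '' K')).comap decimate from
    h ht
  rw [Submodule.span_le]
  rintro _ ⟨T, ⟨hTK, hT⟩, rfl⟩
  have hdecimate : decimate (count T) = ∑ d : Fin m → Fin k,
      count (digitQuotient T (Fin.cons r d : Fin (m + 1) → Fin k)) := by
    funext n
    simp only [decimate, count, LinearMap.funLeft_apply, Finset.sum_apply]
    exact_mod_cast ncard_fiber_mul_add hT n r
  rw [SetLike.mem_coe, Submodule.mem_comap, hdecimate]
  exact Submodule.sum_mem _ fun d _ =>
    Submodule.subset_span ⟨_, ⟨hKd T hTK _, finite_fiber_digitQuotient hT _⟩, rfl⟩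

end Fibers

section Definability

variable {k : ℕ} {α β : Type*}

/-- Definability without parameters in `⟨ℕ, +, V_k⟩` of a function of several variables. -/
def BuchiDefinableFun (k : ℕ) {ι : Type*} (f : (ι → ℕ) → ℕ) : Prop :=
  letI := buchiStructure k
  Set.DefinableFun buchiLanguage (∅ : Set ℕ) f

theorem BuchiDefinable.and {p q : (α → ℕ) → Prop} (hp : BuchiDefinable k {v | p v})
    (hq : BuchiDefinable k {v | q v}) : BuchiDefinable k {v | p v ∧ q v} :=
  letI := buchiStructure k
  Set.Definable.inter hp hq

theorem BuchiDefinable.or {p q : (α → ℕ) → Prop} (hp : BuchiDefinable k {v | p v})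
    (hq : BuchiDefinable k {v | q v}) : BuchiDefinable k {v | p v ∨ q v} :=
  letI := buchiStructure k
  Set.Definable.union hp hq

theorem BuchiDefinable.imp {p q : (α → ℕ) → Prop} (hp : BuchiDefinable k {v | p v})
    (hq : BuchiDefinable k {v | q v}) : BuchiDefinable k {v | p v → q v} :=
  letI := buchiStructure k
  Set.Definable.himp hp hq

theorem BuchiDefinable.all {γ : Type*} [Finite γ] {p : γ → (α → ℕ) → Prop}
    (hp : ∀ c, BuchiDefinable k {v | p c v}) : BuchiDefinable k {v | ∀ c, p c v} := by
  let := buchiStructure k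
  rw [Set.ofPred_forall]
  exact Set.definable_iInter_of_finite hp

theorem buchiDefinable_const (p : Prop) : BuchiDefinable k {_v : α → ℕ | p} := by
  let := buchiStructure k
  by_cases hp : p
  · simp only [hp]
    exact Set.definable_univ
  · simp only [hp]
    exact Set.definable_empty

theorem BuchiDefinable.exists [Finite β] {p : (α → ℕ) → (β → ℕ) → Prop}
    (hp : BuchiDefinable k {w : α ⊕ β → ℕ | p (w ∘ Sum.inl) (w ∘ Sum.inr)}) :
    BuchiDefinable k {v | ∃ u, p v u} :=
  letI := buchiStructure k
  Set.Definable.exists_of_finite hp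

theorem BuchiDefinable.exists_nat {p : (α → ℕ) → ℕ → Prop}
    (hp : BuchiDefinable k {w : α ⊕ Unit → ℕ | p (w ∘ Sum.inl) (w (Sum.inr ()))}) :
    BuchiDefinable k {v | ∃ n, p v n} := by
  simp only [(Equiv.funUnique Unit ℕ).surjective.exists]
  exact .exists hp

theorem BuchiDefinable.forall_nat {p : (α → ℕ) → ℕ → Prop}
    (hp : BuchiDefinable k {w : α ⊕ Unit → ℕ | p (w ∘ Sum.inl) (w (Sum.inr ()))}) :
    BuchiDefinable k {v | ∀ n, p v n} := by
  let := buchiStructure k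
  simp only [(Equiv.funUnique Unit ℕ).surjective.forall]
  exact Set.Definable.forall_of_finite hp

theorem buchiDefinableFun_apply (i : α) : BuchiDefinableFun k fun v : α → ℕ => v i :=
  letI := buchiStructure k
  Set.DefinableFun.proj buchiLanguage

theorem BuchiDefinableFun.comp [Finite α] {f : (α → ℕ) → ℕ} {g : α → (β → ℕ) → ℕ}
    (hf : BuchiDefinableFun k f) (hg : ∀ i, BuchiDefinableFun k (g i)) :
    BuchiDefinableFun k fun v => f fun i => g i v :=
  letI := buchiStructure k
  Set.DefinableFun.comp (g := fun v i => g i v) hg hf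

theorem BuchiDefinableFun.comp_inl [Finite α] {f : (α → ℕ) → ℕ} (hf : BuchiDefinableFun k f) :
    BuchiDefinableFun k fun w : α ⊕ β → ℕ => f (w ∘ Sum.inl) :=
  hf.comp fun i => buchiDefinableFun_apply (Sum.inl i)

theorem BuchiDefinableFun.add {f g : (α → ℕ) → ℕ} (hf : BuchiDefinableFun k f)
    (hg : BuchiDefinableFun k g) : BuchiDefinableFun k fun v => f v + g v := by
  let := buchiStructure k
  have hadd : BuchiDefinableFun k fun v : Fin 2 → ℕ => v 0 + v 1 :=
    Set.DefinableFun.fun_symbol (L := buchiLanguage) (M := ℕ) BuchiFunc.add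
  exact hadd.comp (g := ![f, g]) (Fin.forall_fin_two.2 ⟨hf, hg⟩)

theorem BuchiDefinableFun.powVal {f : (α → ℕ) → ℕ} (hf : BuchiDefinableFun k f) :
    BuchiDefinableFun k fun v => powVal k (f v) := by
  let := buchiStructure k
  have hval : BuchiDefinableFun k fun v : Fin 1 → ℕ => QParikh.powVal k (v 0) :=
    Set.DefinableFun.fun_symbol (L := buchiLanguage) (M := ℕ) BuchiFunc.val
  exact hval.comp (g := fun _ => f) fun _ => hf

theorem BuchiDefinableFun.eq {f g : (α → ℕ) → ℕ} (hf : BuchiDefinableFun k f)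
    (hg : BuchiDefinableFun k g) : BuchiDefinable k {v | f v = g v} :=
  letI := buchiStructure k
  Set.DefinableFun.ofPred_eq hf hg

theorem buchiDefinableFun_zero : BuchiDefinableFun k fun _ : α → ℕ => 0 := by
  have hdouble : BuchiDefinable k {w : Option α → ℕ | w none + w none = w none} :=
    ((buchiDefinableFun_apply none).add (buchiDefinableFun_apply none)).eq
      (buchiDefinableFun_apply none)
  have hgraph : Function.tupleGraph (fun _ : α → ℕ => 0) = {w | w none + w none = w none} := by
    ext w
    simp [Function.tupleGraph, eq_comm]
  change BuchiDefinable k (Function.tupleGraph _)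
  rwa [hgraph]

theorem buchiDefinableFun_one : BuchiDefinableFun k fun _ : α → ℕ => 1 :=
  (buchiDefinableFun_zero (k := k)).powVal

theorem BuchiDefinableFun.const_mul {f : (α → ℕ) → ℕ} (hf : BuchiDefinableFun k f) (d : ℕ) :
    BuchiDefinableFun k fun v => d * f v := by
  induction d with
  | zero => simpa only [zero_mul] using buchiDefinableFun_zero
  | succ d ih => simpa only [Nat.succ_mul] using ih.add hf

theorem BuchiDefinableFun.lt [Finite α] {f g : (α → ℕ) → ℕ} (hf : BuchiDefinableFun k f)
    (hg : BuchiDefinableFun k g) : BuchiDefinable k {v | f v < g v} := by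
  have hlt (v : α → ℕ) : f v < g v ↔ ∃ c, g v = f v + c + 1 :=
    ⟨Nat.exists_eq_add_of_lt, fun ⟨c, hc⟩ => by omega⟩
  simp only [hlt]
  exact .exists_nat (hg.comp_inl.eq
    ((hf.comp_inl.add (buchiDefinableFun_apply (Sum.inr ()))).add buchiDefinableFun_one))

end Definability

section Digits

variable {k : ℕ} {α : Type*}

theorem powVal_pow (hk : 2 ≤ k) (t : ℕ) : powVal k (k ^ t) = k ^ t := by
  have hpow : k ^ t ≠ 0 := pow_ne_zero _ (by omega)
  have hunit : ¬IsUnit k := by rw [Nat.isUnit_iff]; omega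
  rw [powVal, if_neg hpow, multiplicity_pow_self (by omega) hunit]

theorem powVal_eq_self_iff (hk : 2 ≤ k) {p : ℕ} : powVal k p = p ↔ ∃ t, p = k ^ t := by
  refine ⟨fun h => ?_, ?_⟩
  · rw [powVal] at h
    split_ifs at h with hp
    · exact ⟨0, h.symm⟩
    · exact ⟨_, h.symm⟩
  · rintro ⟨t, rfl⟩
    exact powVal_pow hk t

theorem pow_lt_powVal_iff (hk : 2 ≤ k) {n : ℕ} (hn : n ≠ 0) (t : ℕ) :
    k ^ t < powVal k n ↔ k ^ (t + 1) ∣ n := by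
  have hfin : FiniteMultiplicity k n := Nat.finiteMultiplicity_iff.2 ⟨by omega, by omega⟩
  rw [powVal, if_neg hn, Nat.pow_lt_pow_iff_right (by omega), hfin.pow_dvd_iff_le_multiplicity,
    Nat.succ_le_iff]

theorem pow_succ_dvd_iff_powVal (hk : 2 ≤ k) (n t : ℕ) :
    k ^ (t + 1) ∣ n ↔ n = 0 ∨ k ^ t < powVal k n := by
  rcases eq_or_ne n 0 with rfl | hn
  · simp
  · simp [hn, pow_lt_powVal_iff hk hn]

theorem div_pow_mod_eq_iff {d u : ℕ} (hd : d < k) (t : ℕ) :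
    u / k ^ t % k = d ↔ ∃ a b, u = a + d * k ^ t + b ∧ a < k ^ t ∧ k ^ (t + 1) ∣ b := by
  have hpos : 0 < k ^ t := pow_pos (by omega) t
  constructor
  · rintro rfl
    refine ⟨u % k ^ t, k ^ (t + 1) * (u / k ^ t / k), ?_, Nat.mod_lt _ hpos, Nat.dvd_mul_right _ _⟩
    conv_lhs => rw [← Nat.div_add_mod u (k ^ t), ← Nat.div_add_mod (u / k ^ t) k]
    ring
  · rintro ⟨a, _, rfl, ha, c, rfl⟩
    have hfactor : a + d * k ^ t + k ^ (t + 1) * c = a + k ^ t * (d + k * c) := by ring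
    rw [hfactor, Nat.add_mul_div_left _ _ hpos, Nat.div_eq_of_lt ha, zero_add,
      Nat.add_mul_mod_self_left, Nat.mod_eq_of_lt hd]

/-- `p` is a power of `k`, and `d` is the digit of weight `p` in the base-`k` representation
of `u`. -/
def IsDigit (k d u p : ℕ) : Prop := powVal k p = p ∧ u / p % k = d

theorem isDigit_pow_iff (hk : 2 ≤ k) {d u t : ℕ} : IsDigit k d u (k ^ t) ↔ u / k ^ t % k = d :=
  and_iff_right (powVal_pow hk t)

theorem isDigit_iff (hk : 2 ≤ k) {d u p : ℕ} (hd : d < k) :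
    IsDigit k d u p ↔ powVal k p = p ∧
      ∃ a b, u = a + d * p + b ∧ a < p ∧ (b = 0 ∨ p < powVal k b) := by
  refine and_congr_right fun hp => ?_
  obtain ⟨t, rfl⟩ := (powVal_eq_self_iff hk).1 hp
  simp only [div_pow_mod_eq_iff hd, pow_succ_dvd_iff_powVal hk]

theorem buchiDefinable_isDigit [Finite α] (hk : 2 ≤ k) {d : ℕ} (hd : d < k) {u p : (α → ℕ) → ℕ}
    (hu : BuchiDefinableFun k u) (hp : BuchiDefinableFun k p) :
    BuchiDefinable k {v | IsDigit k d (u v) (p v)} := by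
  simp only [isDigit_iff hk hd]
  refine (hp.powVal.eq hp).and (.exists_nat (.exists_nat ?_))
  have ha := buchiDefinableFun_apply (k := k) (Sum.inl (Sum.inr ()) : (α ⊕ Unit) ⊕ Unit)
  have hb := buchiDefinableFun_apply (k := k) (Sum.inr () : (α ⊕ Unit) ⊕ Unit)
  have hp' := hp.comp_inl (β := Unit) |>.comp_inl (β := Unit)
  exact (hu.comp_inl.comp_inl.eq ((ha.add (hp'.const_mul d)).add hb)).and
    ((ha.lt hp').and ((hb.eq buchiDefinableFun_zero).or (hp'.lt hb.powVal)))

theorem exists_digits_eq (N : ℕ) (g : ℕ → ℕ) (hg : ∀ t, g t < k) :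
    ∃ w, ∀ t < N, w / k ^ t % k = g t := by
  have hk : 0 < k := (Nat.zero_le _).trans_lt (hg 0)
  induction N generalizing g with
  | zero => exact ⟨0, fun t ht => absurd ht (Nat.not_lt_zero t)⟩
  | succ N ih =>
    obtain ⟨w, hw⟩ := ih (fun t => g (t + 1)) fun t => hg _
    refine ⟨g 0 + k * w, fun t ht => ?_⟩
    cases t with
    | zero => simp [Nat.mod_eq_of_lt (hg 0)]
    | succ t =>
      rw [pow_succ', ← Nat.div_div_eq_div_mul, Nat.add_mul_div_left _ _ hk,
        Nat.div_eq_of_lt (hg 0), zero_add]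
      exact hw t (by omega)

end Digits

section Automata

variable {k : ℕ} {ι σ : Type*}

/-- The last `N` base-`k` digits of the entries of `v`, least significant digits first, as a word
over the alphabet `ι → Fin k`. -/
def lsdWord (k : ℕ) [NeZero k] (v : ι → ℕ) (N : ℕ) : List (ι → Fin k) :=
  (List.range N).map fun t i => Fin.ofNat k (v i / k ^ t)

theorem lsdWord_succ [NeZero k] (v : ι → ℕ) (N : ℕ) :
    lsdWord k v (N + 1) = lsdWord k v N ++ [fun i => Fin.ofNat k (v i / k ^ N)] := by
  simp [lsdWord, List.range_succ]

/-- The automaton whose states are the members of a family closed under `digitQuotient`, started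
at `S`: after reading the digits `d` at the state `T` it moves to `digitQuotient T d`. -/
def digitQuotientDFA {K : Set (Set (ι → ℕ))}
    (hK : ∀ T ∈ K, ∀ d : ι → Fin k, digitQuotient T d ∈ K) (S : K) : DFA (ι → Fin k) K where
  step T d := ⟨digitQuotient T d, hK T T.2 d⟩
  start := S
  accept := {T | 0 ∈ T.1}

theorem div_pow_mem_eval_digitQuotientDFA_iff [NeZero k] {K : Set (Set (ι → ℕ))}
    (hK : ∀ T ∈ K, ∀ d : ι → Fin k, digitQuotient T d ∈ K) (S : K) (v : ι → ℕ) (N : ℕ) :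
    (fun i => v i / k ^ N) ∈ ((digitQuotientDFA hK S).eval (lsdWord k v N)).1 ↔ v ∈ S.1 := by
  have hstep (T : K) (d : ι → Fin k) (u : ι → ℕ) :
      u ∈ ((digitQuotientDFA hK S).step T d).1 ↔ appendDigits k u d ∈ T.1 := Iff.rfl
  induction N with
  | zero => simp [lsdWord, digitQuotientDFA]
  | succ N ih =>
    simp only [← ih, lsdWord_succ, DFA.eval_append_singleton, hstep, pow_succ,
      ← Nat.div_div_eq_div_mul]
    rw [appendDigits_div_mod fun i => v i / k ^ N]

theorem IsRecognizable.exists_dfa [NeZero k] {S : Set (ι → ℕ)} (hS : IsRecognizable k S) :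
    ∃ K : Set (Set (ι → ℕ)), K.Finite ∧ ∃ M : DFA (ι → Fin k) K,
      ∀ v N, (∀ i, v i < k ^ N) → (lsdWord k v N ∈ M.accepts ↔ v ∈ S) := by
  obtain ⟨K, hfin, hSK, hK⟩ := hS
  refine ⟨K, hfin, digitQuotientDFA hK ⟨S, hSK⟩, fun v N hv => ?_⟩
  rw [← div_pow_mem_eval_digitQuotientDFA_iff hK ⟨S, hSK⟩ v N, DFA.mem_accepts]
  simp only [Nat.div_eq_of_lt (hv _)]
  rfl

/-- Büchi's encoding of an accepting run of `M` on the base-`k` digits of `v`: the run has `t` steps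
where `P = k ^ t`, and the digit of weight `k ^ j` of `w s` is `1` at the state `s` reached after
`j` steps. -/
def IsAcceptingRun (M : DFA (ι → Fin k) σ) (v : ι → ℕ) (w : σ → ℕ) (P : ℕ) : Prop :=
  powVal k P = P ∧ (∀ i, v i < P) ∧ IsDigit k 1 (w M.start) 1 ∧
    (∀ p, p < P → ∀ s d, IsDigit k 1 (w s) p → (∀ i, IsDigit k (d i) (v i) p) →
      IsDigit k 1 (w (M.step s d)) (k * p)) ∧
    ∀ s, IsDigit k 1 (w s) P → s ∈ M.accept

theorem buchiDefinable_exists_isAcceptingRun (hk : 2 ≤ k) [Finite ι] [Finite σ]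
    (M : DFA (ι → Fin k) σ) : BuchiDefinable k {v | ∃ w P, IsAcceptingRun M v w P} := by
  refine .exists (.exists_nat ?_)
  have hv (i : ι) := buchiDefinableFun_apply (k := k) (.inl (.inl i) : (ι ⊕ σ) ⊕ Unit)
  have hw (s : σ) := buchiDefinableFun_apply (k := k) (.inl (.inr s) : (ι ⊕ σ) ⊕ Unit)
  have hP := buchiDefinableFun_apply (k := k) (.inr () : (ι ⊕ σ) ⊕ Unit)
  have hp := buchiDefinableFun_apply (k := k) (.inr () : ((ι ⊕ σ) ⊕ Unit) ⊕ Unit)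
  have hstart := buchiDefinable_isDigit hk hk (hw M.start) buchiDefinableFun_one
  have hstep (s : σ) (d : ι → Fin k) :=
    (buchiDefinable_isDigit hk hk (hw s).comp_inl hp).imp
      ((BuchiDefinable.all fun i => buchiDefinable_isDigit hk (d i).2 (hv i).comp_inl hp).imp
        (buchiDefinable_isDigit hk hk (hw (M.step s d)).comp_inl (hp.const_mul k)))
  have hfinal (s : σ) :=
    (buchiDefinable_isDigit hk hk (hw s) hP).imp (buchiDefinable_const (s ∈ M.accept))
  exact (hP.powVal.eq hP).and ((BuchiDefinable.all fun i => (hv i).lt hP).and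
    (hstart.and ((BuchiDefinable.forall_nat ((hp.lt hP.comp_inl).imp
      (.all fun s => .all fun d => hstep s d))).and (.all hfinal))))

theorem forall_isDigit_pow_iff [NeZero k] (hk : 2 ≤ k) (v : ι → ℕ) (d : ι → Fin k) (t : ℕ) :
    (∀ i, IsDigit k (d i) (v i) (k ^ t)) ↔ (fun i => Fin.ofNat k (v i / k ^ t)) = d := by
  simp only [isDigit_pow_iff hk, funext_iff, Fin.ext_iff, Fin.val_ofNat]

theorem exists_isAcceptingRun [NeZero k] (hk : 2 ≤ k) (M : DFA (ι → Fin k) σ) {v : ι → ℕ} {N : ℕ}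
    (hv : ∀ i, v i < k ^ N) (hM : lsdWord k v N ∈ M.accepts) :
    ∃ w P, IsAcceptingRun M v w P := by
  classical
  let state (t : ℕ) : σ := M.eval (lsdWord k v t)
  have hexists (s : σ) : ∃ w, ∀ t < N + 1, w / k ^ t % k = if state t = s then 1 else 0 :=
    exists_digits_eq (N + 1) _ fun t => by split_ifs <;> omega
  choose w hw using hexists
  have hdigit {s : σ} {t : ℕ} (ht : t ≤ N) : IsDigit k 1 (w s) (k ^ t) ↔ state t = s := by
    simp [isDigit_pow_iff hk, hw s t (by omega)]
  refine ⟨w, k ^ N, powVal_pow hk N, hv, ?_, fun p hp s d hs hd => ?_, fun s hs => ?_⟩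
  · simpa only [pow_zero] using (hdigit N.zero_le).2 (M.eval_nil)
  · obtain ⟨t, rfl⟩ := (powVal_eq_self_iff hk).1 hs.1
    have ht : t < N := (Nat.pow_lt_pow_iff_right (by omega)).1 hp
    have hs : state t = s := (hdigit ht.le).1 hs
    rw [← pow_succ', hdigit ht, ← hs, ← (forall_isDigit_pow_iff hk v d t).1 hd]
    simp only [state, lsdWord_succ, DFA.eval_append_singleton]
  · rwa [← (hdigit le_rfl).1 hs]

theorem IsAcceptingRun.exists_mem_accepts [NeZero k] (hk : 2 ≤ k) {M : DFA (ι → Fin k) σ}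
    {v : ι → ℕ} {w : σ → ℕ} {P : ℕ} (hrun : IsAcceptingRun M v w P) :
    ∃ N, (∀ i, v i < k ^ N) ∧ lsdWord k v N ∈ M.accepts := by
  obtain ⟨hP, hv, hstart, hstep, hfinal⟩ := hrun
  obtain ⟨N, rfl⟩ := (powVal_eq_self_iff hk).1 hP
  have hstate (t : ℕ) (ht : t ≤ N) : IsDigit k 1 (w (M.eval (lsdWord k v t))) (k ^ t) := by
    induction t with
    | zero => exact (pow_zero k).symm ▸ hstart
    | succ t ih =>
      rw [pow_succ', lsdWord_succ, DFA.eval_append_singleton]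
      exact hstep _ (Nat.pow_lt_pow_right (by omega) ht) _ _ (ih (by omega))
        ((forall_isDigit_pow_iff hk v _ t).2 rfl)
  exact ⟨N, hv, hfinal _ (hstate N le_rfl)⟩

theorem exists_forall_lt_pow [Finite ι] (hk : 2 ≤ k) (v : ι → ℕ) : ∃ N, ∀ i, v i < k ^ N := by
  obtain ⟨N, hN⟩ := (Set.finite_range v).bddAbove
  exact ⟨N, fun i => (hN ⟨i, rfl⟩).trans_lt (Nat.lt_pow_self (by omega))⟩

theorem IsRecognizable.buchiDefinable [Finite ι] (hk : 2 ≤ k) {S : Set (ι → ℕ)}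
    (hS : IsRecognizable k S) : BuchiDefinable k S := by
  have : NeZero k := ⟨by omega⟩
  obtain ⟨K, hfin, M, hM⟩ := hS.exists_dfa
  have : Finite K := hfin
  have hmem (v : ι → ℕ) : v ∈ S ↔ ∃ w P, IsAcceptingRun M v w P := by
    constructor
    · intro hv
      obtain ⟨N, hN⟩ := exists_forall_lt_pow hk v
      exact exists_isAcceptingRun hk M hN ((hM v N hN).2 hv)
    · rintro ⟨w, P, hrun⟩
      obtain ⟨N, hN, hacc⟩ := hrun.exists_mem_accepts hk
      exact (hM v N hN).1 hacc
  have hset : S = {v | ∃ w P, IsAcceptingRun M v w P} := Set.ext hmem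
  exact hset ▸ buchiDefinable_exists_isAcceptingRun hk M

end Automata

end QParikh

theorem mainTheorem6_general {A : Type*} [DecidableEq A] (k : ℕ) (hk : 2 ≤ k) (x : ℕ → A)
    (z : List A) (hx : ∀ a ∈ z, (QParikh.kKernel k fun n => x n = a).Finite) :
    QParikh.IsKRegular k (fun n => ((PowerSeries.coeff n (QParikh.qSeries x z) : ℕ) : ℤ)) ∧
    (∀ n, (QParikh.occurrences x z n).Finite ∧
      PowerSeries.coeff n (QParikh.qSeries x z) = (QParikh.occurrences x z n).ncard) ∧
    QParikh.BuchiDefinable k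
      {v : Fin (z.length + 1) → ℕ | Fin.tail v ∈ QParikh.occurrences x z (v 0)} := by
  have : NeZero k := ⟨by omega⟩
  have hfinite (n : ℕ) : (QParikh.occurrences x z n).Finite :=
    QParikh.finite_subwordPositions x z.get (n + z.length * (z.length - 1) / 2)
  have hrec := QParikh.isRecognizable_occurrences hx
  refine ⟨?_, fun n => ⟨hfinite n, QParikh.coeff_qSeries_eq_ncard_occurrences x z n⟩,
    hrec.buchiDefinable hk⟩
  simp only [QParikh.coeff_qSeries_eq_ncard_occurrences]
  exact hrec.isKRegular_ncard_fiber hfinite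

theorem mainTheorem6 {A : Type*} [Finite A] [DecidableEq A] (k : ℕ) (hk : 2 ≤ k)
    (x : ℕ → A) (hx : QParikh.IsKAutomatic k x) (z : List A) :
    QParikh.IsKRegular k (fun n => ((PowerSeries.coeff n (QParikh.qSeries x z) : ℕ) : ℤ)) ∧
    (∀ n, (QParikh.occurrences x z n).Finite ∧
      PowerSeries.coeff n (QParikh.qSeries x z) = (QParikh.occurrences x z n).ncard) ∧
    QParikh.BuchiDefinable k
      {v : Fin (z.length + 1) → ℕ | Fin.tail v ∈ QParikh.occurrences x z (v 0)} := by
  exact mainTheorem6_general k hk x z fun a _ => (hx.comp (· = a)).finite_kKernel hk
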